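/- Let $G$ be a (discrete) group. Throughout, vector spaces are real and functions are real-valued; $G$ acts on functions on $G$ by $(gf)(x)=f(g^{-1}x)$, and functions are ordered pointwise. A representation of $G$ on a vector space is an action by linear maps, assumed continuous if a topology is given and order-preserving if a vector-space pre-order (equivalently, a convex cone) is given. In a pre-ordered vector space with a representation of $G$, an element $\varphi$ is said to $G$-dominate $\lambda$ if there are $g_1,\dots,g_n\in G$ with $\pm\lambda\le\sum_{i} g_i\varphi$. For a bounded function $f\ge 0$ on $G$, let $\ell^\infty(G;f)$ be the ordered vector space of all functions on $G$ that are $G$-dominated by $f$. Then the following properties of $G$ are equivalent. 1. (Fixed-point property for cones.) Let $E$ be any Hausdorff locally convex topological vector space with a representation of $G$ by continuous linear maps preserving a convex cone $C\subseteq E$ that is proper, i.e. $C\cap(-C)=\{0\}$, and complete for the weak uniform structure of $E$. Suppose that some $x\neq 0$ in $C$ has an orbit $Gx$ that is bounded (absorbed by every neighbourhood of $0$), and that some $\varphi$ in the topological dual $E'$ $G$-dominates every $\lambda\in E'$, where $E'$ carries the dual representation and the dual pre-order ($\lambda\le\lambda'$ if and only if $\lambda(c)\le\lambda'(c)$ for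 all $c\in C$). Then $G$ fixes a non-zero point of $C$. 2. (Translate property.) For every non-zero bounded function $f\ge 0$ on $G$ and all $t_1,\dots,t_n\in\mathbb R$, $g_1,\dots,g_n\in G$: if $\sum_i t_i\,g_i f\ge 0$, then $\sum_i t_i\ge 0$. 3. (Abstract translate property.) For every order-preserving linear representation of $G$ on an ordered vector space $V$ and every $v\ge 0$ in $V$ for which there is a positive linear form $\delta\colon V\to\mathbb R$ with $\delta(v)\ne 0$ which is bounded on the orbit $Gv$, and for all $t_1,\dots,t_n\in\mathbb R$, $g_1,\dots,g_n\in G$: if $\sum_i t_i\,g_i v\ge 0$, then $\sum_i t_i\ge 0$. 4. For every non-zero bounded function $f\ge 0$ on $G$ there is a $G$-invariant positive linear form $\mu$ on $\ell^\infty(G;f)$ with $\mu(f)=1$. 5. For every non-zero bounded function $f$ on $G$ (of arbitrary sign), $G$ has the $f$-Reiter property: for every finite set $S\subseteq G$ and every $\epsilon>0$ there is a finitely supported function $u$ on $G$ with $\|(su-u)\cdot f\|_1<\epsilon\,\|u\cdot f\|_1$ for all $s\in S$, where $\|\cdot\|_1$ is the $\ell^1$-norm and $\cdot$ is the pointwise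 product. -/

import Mathlib

universe u v w

namespace ConicalFixedPoint

/-- For a linear representation `ρ` of `G` on a vector space `V` with pre-order `le`, the vector
`φ` **`G`-dominates** `x` if `x ≤ ∑ i, g i • φ` and `-x ≤ ∑ i, g i • φ` for some finite family
`g` in `G`. -/
def GDominates {G : Type*} [Group G] {V : Type*} [AddCommGroup V] [Module ℝ V]
    (ρ : Representation ℝ G V) (le : V → V → Prop) (φ x : V) : Prop :=
  ∃ (n : ℕ) (g : Fin n → G), le x (∑ i, ρ (g i) φ) ∧ le (-x) (∑ i, ρ (g i) φ)

section Cones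

variable {G : Type u} [Group G] {E : Type v} [AddCommGroup E] [Module ℝ E] [TopologicalSpace E]
  [IsTopologicalAddGroup E] [ContinuousSMul ℝ E]

/-- The contragredient representation on the topological dual: `(g • l) x = l (g⁻¹ • x)`. -/
def dualRep (ρ : G →* (E →L[ℝ] E)) : Representation ℝ G (E →L[ℝ] ℝ) where
  toFun g :=
    { toFun := fun l => l.comp (ρ g⁻¹)
      map_add' := fun _ _ => rfl
      map_smul' := fun _ _ => rfl }
  map_one' := by
    ext l x
    simp
  map_mul' g h := by
    refine LinearMap.ext fun l => ContinuousLinearMap.ext fun x => ?_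
    change l (ρ (g * h)⁻¹ x) = l (ρ h⁻¹ (ρ g⁻¹ x))
    simp

/-- The dual pre-order on the topological dual of a space `E` pre-ordered by a convex cone `C`. -/
def DualLE (C : ConvexCone ℝ E) (l m : E →L[ℝ] ℝ) : Prop :=
  ∀ x ∈ C, l x ≤ m x

/-- `C ∩ (-C) = {0}`. -/
def IsProperCone (C : ConvexCone ℝ E) : Prop :=
  (C : Set E) ∩ -(C : Set E) = {0}

/-- The cone is complete for the (translation-invariant) uniform structure of the weak topology
of the ambient space. -/
def IsWeaklyComplete (C : ConvexCone ℝ E) : Prop :=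
  letI : UniformSpace (WeakSpace ℝ E) :=
    IsTopologicalAddGroup.rightUniformSpace (WeakSpace ℝ E)
  IsComplete (toWeakSpace ℝ E '' (C : Set E))

/-- Some non-zero element of the cone has a bounded orbit, where bounded means absorbed by every
neighbourhood of zero. -/
def IsLocallyBoundedType (ρ : G →* (E →L[ℝ] E)) (C : ConvexCone ℝ E) : Prop :=
  ∃ x ∈ C, x ≠ 0 ∧ Bornology.IsVonNBounded ℝ (Set.range fun g : G => ρ g x)

/-- Some continuous linear form `G`-dominates all continuous linear forms. -/
def IsCoboundedType (ρ : G →* (E →L[ℝ] E)) (C : ConvexCone ℝ E) : Prop :=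
  ∃ φ : E →L[ℝ] ℝ, ∀ l : E →L[ℝ] ℝ, GDominates (dualRep ρ) (DualLE C) φ l

end Cones

/-- The fixed-point property for cones: every representation of locally bounded cobounded type on
a weakly complete proper convex cone in a Hausdorff locally convex space has a non-zero fixed
point in the cone. -/
def FixedPointPropertyForCones (G : Type u) [Group G] : Prop :=
  ∀ (E : Type v) [AddCommGroup E] [Module ℝ E] [TopologicalSpace E] [IsTopologicalAddGroup E]
    [ContinuousSMul ℝ E] [LocallyConvexSpace ℝ E] [T2Space E]
    (C : ConvexCone ℝ E) (ρ : G →* (E →L[ℝ] E)),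
    IsProperCone C → IsWeaklyComplete C → (∀ g : G, ∀ x ∈ C, ρ g x ∈ C) →
    IsLocallyBoundedType ρ C → IsCoboundedType ρ C →
    ∃ x ∈ C, x ≠ 0 ∧ ∀ g : G, ρ g x = x

section Functions

variable {G : Type u} [Group G]

/-- Left translation of real functions on `G`: `(g • f) x = f (g⁻¹ * x)`. -/
def leftTranslation (G : Type u) [Group G] : Representation ℝ G (G → ℝ) where
  toFun g :=
    { toFun := fun f x => f (g⁻¹ * x)
      map_add' := fun _ _ => rfl
      map_smul' := fun _ _ => rfl }
  map_one' := by
    ext f x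
    simp
  map_mul' g h := by
    refine LinearMap.ext fun f => funext fun x => ?_
    simp [mul_assoc]

theorem leftTranslation_apply (g : G) (f : G → ℝ) (x : G) :
    leftTranslation G g f x = f (g⁻¹ * x) := rfl

/-- Boundedness of a real function. -/
def IsBoundedFun (f : G → ℝ) : Prop := ∃ M : ℝ, ∀ x, |f x| ≤ M

theorem gDominates_iff (f h : G → ℝ) :
    GDominates (leftTranslation G) (· ≤ ·) f h ↔
      ∃ (n : ℕ) (g : Fin n → G), ∀ x, |h x| ≤ ∑ i, f ((g i)⁻¹ * x) := by
  unfold GDominates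
  refine exists_congr fun n => exists_congr fun g => ?_
  simp only [Pi.le_def, Finset.sum_apply, leftTranslation_apply, Pi.neg_apply, abs_le,
    ← forall_and]
  refine forall_congr' fun x => ?_
  constructor
  · rintro ⟨h1, h2⟩
    exact ⟨by linarith, h1⟩
  · rintro ⟨h1, h2⟩
    exact ⟨h2, by linarith⟩

theorem gDominates_zero (f : G → ℝ) : GDominates (leftTranslation G) (· ≤ ·) f 0 := by
  rw [gDominates_iff]
  exact ⟨0, Fin.elim0, fun x => by simp⟩

theorem gDominates_add {f h k : G → ℝ} (hh : GDominates (leftTranslation G) (· ≤ ·) f h)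
    (hk : GDominates (leftTranslation G) (· ≤ ·) f k) :
    GDominates (leftTranslation G) (· ≤ ·) f (h + k) := by
  rw [gDominates_iff] at *
  obtain ⟨n, a, ha⟩ := hh
  obtain ⟨m, b, hb⟩ := hk
  refine ⟨n + m, Fin.append a b, fun x => ?_⟩
  rw [Fin.sum_univ_add]
  simp only [Fin.append_left, Fin.append_right]
  exact (abs_add_le _ _).trans (add_le_add (ha x) (hb x))

theorem gDominates_smul (c : ℝ) {f h : G → ℝ}
    (hh : GDominates (leftTranslation G) (· ≤ ·) f h) :
    GDominates (leftTranslation G) (· ≤ ·) f (c • h) := by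
  have nat : ∀ N : ℕ, GDominates (leftTranslation G) (· ≤ ·) f ((N : ℝ) • h) := by
    intro N
    induction N with
    | zero => simpa using gDominates_zero f
    | succ N ih =>
      have := gDominates_add ih hh
      rwa [Nat.cast_succ, add_smul, one_smul]
  obtain ⟨N, hN⟩ := exists_nat_ge |c|
  have key := nat N
  rw [gDominates_iff] at *
  obtain ⟨n, g, hg⟩ := key
  refine ⟨n, g, fun x => le_trans ?_ (hg x)⟩
  simp only [Pi.smul_apply, smul_eq_mul, abs_mul, Nat.abs_cast]
  exact mul_le_mul_of_nonneg_right hN (abs_nonneg _)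

/-- The space `ℓ^∞(G; f)` of all functions on `G` that are `G`-dominated by `f`. -/
def ellInf (f : G → ℝ) : Submodule ℝ (G → ℝ) where
  carrier := {h | GDominates (leftTranslation G) (· ≤ ·) f h}
  zero_mem' := gDominates_zero f
  add_mem' := gDominates_add
  smul_mem' := fun c _ hh => gDominates_smul c hh

theorem self_mem_ellInf {f : G → ℝ} (hf : 0 ≤ f) : f ∈ ellInf f := by
  refine (gDominates_iff f f).2 ⟨1, fun _ => 1, fun x => ?_⟩
  simp [abs_of_nonneg (hf x)]

theorem translate_mem_ellInf {f h : G → ℝ} (g : G) (hh : h ∈ ellInf f) :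
    leftTranslation G g h ∈ ellInf f := by
  obtain ⟨n, a, ha⟩ := (gDominates_iff f h).1 hh
  refine (gDominates_iff f _).2 ⟨n, fun i => g * a i, fun x => ?_⟩
  simpa [leftTranslation_apply, mul_assoc] using ha (g⁻¹ * x)

/-- For `f ≥ 0`, the linear form `μ` on `ℓ^∞(G; f)` is a `G`-invariant positive linear form with
`μ f = 1`. -/
structure IsIntegral (f : G → ℝ) (hf : 0 ≤ f) (μ : ellInf f →ₗ[ℝ] ℝ) : Prop where
  nonneg : ∀ h : ellInf f, 0 ≤ (h : G → ℝ) → 0 ≤ μ h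
  invariant : ∀ (g : G) (h : ellInf f),
    μ ⟨leftTranslation G g h, translate_mem_ellInf g h.2⟩ = μ h
  normalised : μ ⟨f, self_mem_ellInf hf⟩ = 1

/-- The `ℓ¹`-norm, used only for finitely supported functions. -/
noncomputable def l1Norm (h : G → ℝ) : ℝ := ∑' x, |h x|

/-- The `f`-Reiter property: for every finite `S` and every `ε > 0` there is a finitely supported
`u` with `‖(s u - u) f‖₁ < ε ‖u f‖₁` for all `s ∈ S`. -/
def ReiterProperty (f : G → ℝ) : Prop :=
  ∀ (S : Finset G) (ε : ℝ), 0 < ε → ∃ u : G →₀ ℝ, ∀ s ∈ S,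
    l1Norm ((leftTranslation G s ⇑u - ⇑u) * f) < ε * l1Norm (⇑u * f)

end Functions

/-- The translate property for all non-zero bounded functions `f ≥ 0`. -/
def TranslateProperty (G : Type u) [Group G] : Prop :=
  ∀ f : G → ℝ, 0 ≤ f → f ≠ 0 → IsBoundedFun f →
    ∀ (n : ℕ) (t : Fin n → ℝ) (g : Fin n → G),
      0 ≤ ∑ i, t i • leftTranslation G (g i) f → 0 ≤ ∑ i, t i

/-- The abstract translate property, for order-preserving representations on ordered vector
spaces. -/
def AbstractTranslateProperty (G : Type u) [Group G] : Prop :=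
  ∀ (V : Type w) [AddCommGroup V] [PartialOrder V] [IsOrderedAddMonoid V] [Module ℝ V]
    [IsOrderedModule ℝ V] (ρ : Representation ℝ G V), (∀ g : G, Monotone (ρ g)) →
    ∀ v : V, 0 ≤ v →
      (∃ δ : V →ₗ[ℝ] ℝ, (∀ x, 0 ≤ x → 0 ≤ δ x) ∧ δ v ≠ 0 ∧ ∃ M : ℝ, ∀ g : G, |δ (ρ g v)| ≤ M) →
    ∀ (n : ℕ) (t : Fin n → ℝ) (g : Fin n → G),
      0 ≤ ∑ i, t i • ρ (g i) v → 0 ≤ ∑ i, t i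

end ConicalFixedPoint

namespace ConicalFixedPoint

/-! ### Translate property and amenability -/

section Translate

variable {G : Type u} [Group G]

/-! Invariant integrals (4) are the hub. On the span of the translates of `f`, the candidate
integral sends `∑ c_g g f` to `∑ c_g`. The translate property says exactly that this is well defined
and positive, and domination by `f` lets Riesz extension carry it to `ℓ^∞(G; f)`
(`TranslateProperty.exists_positive_form`). The extension is constant on the orbit of `f` but need
not be invariant, so it is averaged over `G`, which requires amenability.

Amenability also follows from the translate property. If no finitely supported function is almost
invariant, a Kesten-type estimate makes the convolution powers of a finite set `T` grow more slowly
than `|T| ^ m`. A resolvent series then gives a bounded `f > 0` at `1` with `∑_{s ∈ T} s f ≤ r f`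
and `r < |T|`, a contradiction (`TranslateProperty.exists_almost_invariant`).

The Reiter property is the Hahn-Banach dual of having an invariant integral, and pairing with `|u|`
leads back to translates. For cones, a point `x` with bounded orbit turns functionals `l` into
functions `g ↦ l (g x)`; an integral pulls back to a functional on `E'`, which weak completeness
represents by a fixed point. Conversely, the positive forms on `ℓ^∞(G; f)` are themselves a cone of
the required type. -/

theorem TranslateProperty.fintype (h : TranslateProperty G) {f : G → ℝ} (hf : 0 ≤ f) (hf0 : f ≠ 0)
    (hb : IsBoundedFun f) {ι : Type*} [Fintype ι] (t : ι → ℝ) (g : ι → G)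
    (hs : ∀ x, 0 ≤ ∑ i, t i * f ((g i)⁻¹ * x)) : 0 ≤ ∑ i, t i := by
  let e := (Fintype.equivFin ι).symm
  rw [← e.sum_comp]
  refine h f hf hf0 hb _ (fun i => t (e i)) (fun i => g (e i)) fun x => ?_
  have := hs x
  rw [← e.sum_comp] at this
  simpa [leftTranslation_apply] using this

/-- The defect in Cauchy-Schwarz, `n ∑ a_i² - (∑ a_i)²`, is unchanged when `a_j` is subtracted from
every entry. The `j`-th entry then vanishes, so Cauchy-Schwarz holds with `n - 1` in place of `n`,
which leaves one spare copy of `∑ (a_i - a_j)²`. -/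
theorem sq_sum_add_sum_sq_sub_le {ι : Type*} (T : Finset ι) {j : ι} (hj : j ∈ T) (a : ι → ℝ) :
    (∑ i ∈ T, a i) ^ 2 + ∑ i ∈ T, (a i - a j) ^ 2 ≤ T.card * ∑ i ∈ T, a i ^ 2 := by
  classical
  have h1 : (∑ i ∈ T, (a i - a j)) ^ 2 ≤ (T.card - 1) * ∑ i ∈ T, (a i - a j) ^ 2 := by
    rw [← Finset.add_sum_erase T _ hj, ← Finset.add_sum_erase T (fun i => (a i - a j) ^ 2) hj]
    have h2 := sq_sum_le_card_mul_sum_sq (s := T.erase j) (f := fun i => a i - a j)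
    rw [Finset.cast_card_erase_of_mem hj] at h2
    simpa using h2
  have h3 : ∑ i ∈ T, (a i - a j) = ∑ i ∈ T, a i - T.card * a j := by simp
  have h4 : ∑ i ∈ T, (a i - a j) ^ 2
      = ∑ i ∈ T, a i ^ 2 - 2 * a j * ∑ i ∈ T, a i + T.card * a j ^ 2 := by
    simp only [sub_sq, Finset.sum_add_distrib, Finset.sum_sub_distrib, Finset.sum_const,
      nsmul_eq_mul, Finset.mul_sum]
    congr 2
    exact Finset.sum_congr rfl fun i _ => by ring
  rw [h3] at h1
  rw [h4] at h1 ⊢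
  nlinarith

theorem support_translate_finite {u : G → ℝ} (hu : u.support.Finite) (s : G) :
    (Function.support fun x => u (s⁻¹ * x)).Finite :=
  hu.preimage (f := fun x => s⁻¹ * x) (mul_right_injective _).injOn

theorem tsum_translate (u : G → ℝ) (s : G) : ∑' x, u (s⁻¹ * x) = ∑' x, u x :=
  (Equiv.mulLeft s⁻¹).tsum_eq u

theorem abs_sq_sub_sq_le {K : ℝ} (hK : 0 < K) (a b : ℝ) :
    |a ^ 2 - b ^ 2| ≤ K / 2 * (a - b) ^ 2 + 1 / K * (a ^ 2 + b ^ 2) := by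
  have h1 : |a ^ 2 - b ^ 2| = |a - b| * |a + b| := by rw [← abs_mul]; ring_nf
  have h2 : |a - b| * |a + b| ≤ K / 2 * (a - b) ^ 2 + 1 / (2 * K) * (a + b) ^ 2 := by
    have h3 : K / 2 * (a - b) ^ 2 + 1 / (2 * K) * (a + b) ^ 2 - |a - b| * |a + b|
        = 1 / (2 * K) * (K * |a - b| - |a + b|) ^ 2 := by
      rw [← sq_abs (a - b), ← sq_abs (a + b)]
      field_simp
      ring
    have h4 : 0 ≤ 1 / (2 * K) * (K * |a - b| - |a + b|) ^ 2 := by positivity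
    linarith
  have h5 : 1 / (2 * K) * (a + b) ^ 2 ≤ 1 / K * (a ^ 2 + b ^ 2) := by
    have : 1 / K * (a ^ 2 + b ^ 2) - 1 / (2 * K) * (a + b) ^ 2 = 1 / (2 * K) * (a - b) ^ 2 := by
      field_simp
      ring
    have h4 : 0 ≤ 1 / (2 * K) * (a - b) ^ 2 := by positivity
    linarith
  linarith

/-- If finitely supported functions are never almost invariant in `ℓ¹`, then convolution by the
indicator function of `T` has norm less than the cardinality of `T` on `ℓ²`. -/
theorem tsum_sq_sum_translate_le {T : Finset G} (hT : 1 ∈ T) {ε : ℝ} (hε : 0 < ε)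
    (H : ∀ u : G → ℝ, u.support.Finite → 0 ≤ u →
      ε * ∑' x, u x ≤ ∑ s ∈ T, ∑' x, |u (s⁻¹ * x) - u x|)
    {v : G → ℝ} (hv : v.support.Finite) :
    ∑' x, (∑ s ∈ T, v (s⁻¹ * x)) ^ 2
      ≤ ((T.card : ℝ) ^ 2 - ε ^ 2 / (4 * T.card)) * ∑' x, v x ^ 2 := by
  have hn : (0 : ℝ) < T.card := by exact_mod_cast Finset.card_pos.2 ⟨1, hT⟩
  have hv2 : (Function.support fun x => v x ^ 2).Finite :=
    hv.subset fun x hx hx' => hx (by simp_all)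
  have sv (s : G) : Summable fun x => v (s⁻¹ * x) ^ 2 :=
    summable_of_hasFiniteSupport (support_translate_finite hv2 s)
  have sv1 : Summable fun x => v x ^ 2 := summable_of_hasFiniteSupport hv2
  have sd (s : G) : Summable fun x => (v (s⁻¹ * x) - v x) ^ 2 := by
    refine summable_of_hasFiniteSupport
      (((support_translate_finite hv s).union hv).subset fun x hx => ?_)
    by_contra h
    simp only [Set.mem_union, Function.mem_support, not_or, not_not] at h
    exact hx (by simp [h.1, h.2])
  have sp : Summable fun x => (∑ s ∈ T, v (s⁻¹ * x)) ^ 2 := by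
    refine Summable.of_nonneg_of_le (fun x => sq_nonneg _)
      (fun x => sq_sum_le_card_mul_sum_sq) ?_
    exact (summable_sum fun s _ => sv s).mul_left _
  have tv (s : G) : ∑' x, v (s⁻¹ * x) ^ 2 = ∑' x, v x ^ 2 := tsum_translate (fun x => v x ^ 2) s
  have h1 : ∑' x, (∑ s ∈ T, v (s⁻¹ * x)) ^ 2 + ∑ s ∈ T, ∑' x, (v (s⁻¹ * x) - v x) ^ 2
      ≤ (T.card : ℝ) ^ 2 * ∑' x, v x ^ 2 := by
    rw [← Summable.tsum_finsetSum (fun s _ => sd s),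
      ← Summable.tsum_add sp (summable_sum fun s _ => sd s)]
    have : (T.card : ℝ) ^ 2 * ∑' x, v x ^ 2 = ∑' x, T.card * ∑ s ∈ T, v (s⁻¹ * x) ^ 2 := by
      rw [tsum_mul_left, Summable.tsum_finsetSum (fun s _ => sv s)]
      simp [tv]
      ring
    rw [this]
    refine Summable.tsum_le_tsum (fun x => ?_) (sp.add (summable_sum fun s _ => sd s))
      ((summable_sum fun s _ => sv s).mul_left _)
    simpa using sq_sum_add_sum_sq_sub_le T hT fun s => v (s⁻¹ * x)
  -- Passing from `ℓ¹` to `ℓ²`: the hypothesis is applied to `v²`. The value of `K` makes the error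
  -- term in `abs_sq_sub_sq_le`, summed over `T`, exactly half of the left side, so it can be
  -- absorbed.
  have h2 := H _ hv2 fun x => sq_nonneg _
  set K : ℝ := 4 * T.card / ε with hKdef
  have hK : 0 < K := by positivity
  have h3 (s : G) : ∑' x, |v (s⁻¹ * x) ^ 2 - v x ^ 2|
      ≤ K / 2 * ∑' x, (v (s⁻¹ * x) - v x) ^ 2 + 2 / K * ∑' x, v x ^ 2 := by
    have hr : Summable fun x => K / 2 * (v (s⁻¹ * x) - v x) ^ 2
        + 1 / K * (v (s⁻¹ * x) ^ 2 + v x ^ 2) :=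
      ((sd s).mul_left _).add (((sv s).add sv1).mul_left _)
    calc _ ≤ ∑' x, (K / 2 * (v (s⁻¹ * x) - v x) ^ 2 + 1 / K * (v (s⁻¹ * x) ^ 2 + v x ^ 2)) :=
          Summable.tsum_le_tsum (fun x => abs_sq_sub_sq_le hK _ _)
            (hr.of_nonneg_of_le (fun _ => abs_nonneg _) fun x => abs_sq_sub_sq_le hK _ _) hr
      _ = _ := by
          rw [Summable.tsum_add ((sd s).mul_left _) (((sv s).add sv1).mul_left _), tsum_mul_left,
            tsum_mul_left, Summable.tsum_add (sv s) sv1, tv]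
          ring
  have h4 := h2.trans (Finset.sum_le_sum fun s _ => h3 s)
  rw [Finset.sum_add_distrib, ← Finset.mul_sum, Finset.sum_const, nsmul_eq_mul] at h4
  have h5 : (T.card : ℝ) * (2 / K * ∑' x, v x ^ 2) = ε / 2 * ∑' x, v x ^ 2 := by
    rw [hKdef]; field_simp; ring
  have h6 : ε ^ 2 / (4 * T.card) * ∑' x, v x ^ 2 ≤ ∑ s ∈ T, ∑' x, (v (s⁻¹ * x) - v x) ^ 2 := by
    rw [h5] at h4
    have h7 : ε / 2 * ∑' x, v x ^ 2 ≤ K / 2 * ∑ s ∈ T, ∑' x, (v (s⁻¹ * x) - v x) ^ 2 := by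
      linarith
    calc ε ^ 2 / (4 * T.card) * ∑' x, v x ^ 2 = (2 / K) * (ε / 2 * ∑' x, v x ^ 2) := by
          rw [hKdef]; field_simp
      _ ≤ (2 / K) * (K / 2 * ∑ s ∈ T, ∑' x, (v (s⁻¹ * x) - v x) ^ 2) := by gcongr
      _ = _ := by field_simp
  linarith

/-- The iterated convolutions of the point mass at `1` by the indicator function of `T`. -/
noncomputable def convPow (T : Finset G) (m : ℕ) : G → ℝ :=
  ((fun (v : G → ℝ) x => ∑ s ∈ T, v (s⁻¹ * x))^[m]) (Set.indicator {1} 1)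

theorem convPow_succ (T : Finset G) (m : ℕ) (x : G) :
    convPow T (m + 1) x = ∑ s ∈ T, convPow T m (s⁻¹ * x) := by
  rw [convPow, Function.iterate_succ_apply']
  rfl

theorem convPow_zero (T : Finset G) (x : G) : convPow T 0 x = Set.indicator {1} 1 x := rfl

theorem convPow_nonneg (T : Finset G) (m : ℕ) (x : G) : 0 ≤ convPow T m x := by
  induction m generalizing x with
  | zero => exact Set.indicator_nonneg (fun _ _ => zero_le_one) _
  | succ m ih => rw [convPow_succ]; exact Finset.sum_nonneg fun s _ => ih _

theorem support_convPow_finite (T : Finset G) (m : ℕ) : (convPow T m).support.Finite := by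
  induction m with
  | zero => exact (Set.finite_singleton 1).subset Set.support_indicator_subset
  | succ m ih =>
    refine (T.finite_toSet.biUnion fun s _ => support_translate_finite ih s).subset fun x hx => ?_
    rw [Function.mem_support, convPow_succ] at hx
    obtain ⟨s, hs, h⟩ := Finset.exists_ne_zero_of_sum_ne_zero hx
    exact Set.mem_biUnion hs h

/-- The translate property for functions of exponential decay produces almost invariant finitely
supported functions. -/
theorem TranslateProperty.exists_almost_invariant (h : TranslateProperty G) (S : Finset G)
    {ε : ℝ} (hε : 0 < ε) :
    ∃ u : G → ℝ, u.support.Finite ∧ 0 ≤ u ∧ ∑' x, u x = 1 ∧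
      ∀ s ∈ S, ∑' x, |u (s⁻¹ * x) - u x| < ε := by
  classical
  set T := insert 1 S with hTdef
  have hT : (1 : G) ∈ T := Finset.mem_insert_self _ _
  by_cases H : ∀ u : G → ℝ, u.support.Finite → 0 ≤ u →
      ε * ∑' x, u x ≤ ∑ s ∈ T, ∑' x, |u (s⁻¹ * x) - u x|
  · exfalso
    have hn : (0 : ℝ) < T.card := by exact_mod_cast Finset.card_pos.2 ⟨1, hT⟩
    set n : ℝ := (T.card : ℝ)
    -- `q` bounds the `ℓ²` operator norm of convolution by `T`. The maximum with `n / 2` keeps it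
    -- positive even if the radicand is not.
    obtain ⟨q, hq0, hqn, hq⟩ : ∃ q : ℝ, 0 < q ∧ q < n ∧ n ^ 2 - ε ^ 2 / (4 * n) ≤ q ^ 2 := by
      refine ⟨max (n / 2) (Real.sqrt (n ^ 2 - ε ^ 2 / (4 * n))), ?_, ?_, ?_⟩
      · exact lt_max_of_lt_left (by positivity)
      · refine max_lt (by linarith) ?_
        rw [Real.sqrt_lt' hn]
        have : 0 < ε ^ 2 / (4 * n) := by positivity
        linarith
      · rcases le_total 0 (n ^ 2 - ε ^ 2 / (4 * n)) with h0 | h0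
        · calc _ = Real.sqrt (n ^ 2 - ε ^ 2 / (4 * n)) ^ 2 := (Real.sq_sqrt h0).symm
            _ ≤ _ := pow_le_pow_left₀ (Real.sqrt_nonneg _) (le_max_right _ _) 2
        · exact h0.trans (sq_nonneg _)
    have norm_le (m : ℕ) : ∑' x, convPow T m x ^ 2 ≤ (q ^ 2) ^ m := by
      induction m with
      | zero =>
        rw [tsum_eq_single 1 fun x hx => by simp [convPow_zero, hx]]
        simp [convPow_zero]
      | succ m ih =>
        have h1 := tsum_sq_sum_translate_le hT hε H (support_convPow_finite T m)
        simp only [convPow_succ]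
        refine h1.trans ?_
        have h2 : 0 ≤ ∑' x, convPow T m x ^ 2 := tsum_nonneg fun _ => sq_nonneg _
        calc _ ≤ q ^ 2 * ∑' x, convPow T m x ^ 2 := by gcongr
          _ ≤ q ^ 2 * (q ^ 2) ^ m := by gcongr
          _ = _ := by ring
    have point_le (m : ℕ) (x : G) : convPow T m x ≤ q ^ m := by
      have h1 : Summable fun x => convPow T m x ^ 2 :=
        summable_of_hasFiniteSupport ((support_convPow_finite T m).subset
          fun x hx hx' => hx (by simp_all))
      have h2 := (h1.le_tsum x fun _ _ => sq_nonneg _).trans (norm_le m)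
      rw [← pow_mul, mul_comm, pow_mul] at h2
      exact le_of_sq_le_sq h2 (by positivity)
    obtain ⟨r, hqr, hrn⟩ := exists_between hqn
    have hr : 0 < r := hq0.trans hqr
    have term_le (m : ℕ) (x : G) : convPow T m x / r ^ m ≤ (q / r) ^ m := by
      rw [div_pow]
      gcongr
      exact point_le m x
    have hgeo : Summable fun m : ℕ => (q / r) ^ m :=
      summable_geometric_of_lt_one (by positivity) ((div_lt_one hr).2 hqr)
    have hsum (x : G) : Summable fun m => convPow T m x / r ^ m :=
      hgeo.of_nonneg_of_le (fun m => div_nonneg (convPow_nonneg T m x) (by positivity))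
        fun m => term_le m x
    -- A resolvent series: convolving with `T` shifts the index and multiplies by `r`, losing only
    -- the term `m = 0`. Convergence needs `q < r`; the contradiction needs `r < n`.
    set f : G → ℝ := fun x => ∑' m, convPow T m x / r ^ m with hf
    have hf0 : 0 ≤ f := fun x => tsum_nonneg fun m =>
      div_nonneg (convPow_nonneg T m x) (by positivity)
    have hf1 : f ≠ 0 := fun h0 => by
      have h1 := (hsum 1).le_tsum 0 fun m _ => div_nonneg (convPow_nonneg T m 1) (by positivity)
      have h2 : f 1 = 0 := congrFun h0 1
      simp only [hf] at h2
      rw [h2] at h1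
      simp [convPow_zero] at h1
      linarith
    have hfb : IsBoundedFun f := ⟨∑' m, (q / r) ^ m, fun x => by
      rw [abs_of_nonneg (hf0 x)]
      exact (hsum x).tsum_le_tsum (fun m => term_le m x) hgeo⟩
    have hconv (x : G) : ∑ s ∈ T, f (s⁻¹ * x) ≤ r * f x := by
      simp only [hf]
      rw [← Summable.tsum_finsetSum fun s _ => hsum _, (hsum x).tsum_eq_zero_add, mul_add,
        ← tsum_mul_left]
      have h1 : ∀ m, ∑ s ∈ T, convPow T m (s⁻¹ * x) / r ^ m
          = r * (convPow T (m + 1) x / r ^ (m + 1)) := fun m => by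
        rw [convPow_succ, ← Finset.sum_div, pow_succ]
        field_simp
      simp only [h1]
      have h2 := convPow_nonneg T 0 x
      have : 0 ≤ r * (convPow T 0 x / r ^ 0) := by positivity
      linarith
    -- The extra index `none` carries the term `r f`, so the coefficients sum to `r - n`.
    have key := h.fintype hf0 hf1 hfb (ι := Option T) (fun i => i.elim r fun _ => -1)
      (fun i => i.elim 1 fun s => s) fun x => by
        have := hconv x
        rw [← Finset.sum_coe_sort] at this
        simpa [-Finset.univ_eq_attach, Fintype.sum_option] using this
    simp [Fintype.sum_option] at key
    change n ≤ r at key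
    linarith
  · push Not at H
    obtain ⟨u, hu, hu0, hlt⟩ := H
    have hpos : 0 < ∑' x, u x := by
      refine (tsum_nonneg hu0).lt_of_ne fun h0 => ?_
      rw [← h0, mul_zero] at hlt
      exact absurd hlt (not_lt.2 (Finset.sum_nonneg fun s _ => tsum_nonneg fun x => abs_nonneg _))
    set c := ∑' x, u x
    refine ⟨fun x => c⁻¹ * u x, hu.subset fun x hx hx' => hx (by simp_all),
      fun x => mul_nonneg (by positivity) (hu0 x), ?_, fun s hs => ?_⟩
    · rw [tsum_mul_left]
      exact inv_mul_cancel₀ hpos.ne'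
    · have h1 : ∑' x, |u (s⁻¹ * x) - u x| ≤ ∑ s ∈ T, ∑' x, |u (s⁻¹ * x) - u x| :=
        Finset.single_le_sum (f := fun s => ∑' x, |u (s⁻¹ * x) - u x|)
          (fun s _ => tsum_nonneg fun x => abs_nonneg _) (Finset.mem_insert_of_mem hs)
      simp only [← mul_sub, abs_mul, abs_of_pos (inv_pos.2 hpos)]
      rw [tsum_mul_left]
      calc _ < c⁻¹ * (ε * c) := by gcongr; exact h1.trans_lt hlt
        _ = ε := by field_simp

end Translate

/-! ### Extension of linear forms prescribed along a linear map -/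

section Extension

variable {W E : Type*} [AddCommGroup W] [Module ℝ W] [AddCommGroup E] [Module ℝ E]

/-- Lets the extension theorems be used with a form given on parameters `w`, although `a` need not
be injective. -/
theorem exists_factor_range (a : W →ₗ[ℝ] E) (b : W →ₗ[ℝ] ℝ) (h : ∀ w, a w = 0 → b w = 0) :
    ∃ L : LinearMap.range a →ₗ[ℝ] ℝ, ∀ w, L (a.rangeRestrict w) = b w := by
  obtain ⟨s, hs⟩ := a.rangeRestrict.exists_rightInverse_of_surjective a.range_rangeRestrict
  refine ⟨b.comp s, fun w => ?_⟩
  have h1 : a.rangeRestrict (s (a.rangeRestrict w)) = a.rangeRestrict w :=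
    LinearMap.congr_fun hs _
  have h2 : a (s (a.rangeRestrict w)) = a w := congrArg Subtype.val h1
  have h3 := h (s (a.rangeRestrict w) - w) (by rw [map_sub, h2, sub_self])
  rw [map_sub, sub_eq_zero] at h3
  exact h3

theorem exists_positive_extension (C : PointedCone ℝ E) (a : W →ₗ[ℝ] E) (b : W →ₗ[ℝ] ℝ)
    (hpos : ∀ w, a w ∈ C → 0 ≤ b w) (hdense : ∀ y, ∃ w, a w + y ∈ C) :
    ∃ L : E →ₗ[ℝ] ℝ, (∀ w, L (a w) = b w) ∧ ∀ x ∈ C, 0 ≤ L x := by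
  obtain ⟨L, hL⟩ := exists_factor_range a b fun w hw => by
    have h1 := hpos w (by rw [hw]; exact C.zero_mem)
    have h2 := hpos (-w) (by rw [map_neg, hw, neg_zero]; exact C.zero_mem)
    rw [map_neg] at h2
    linarith
  obtain ⟨g, hg, hgC⟩ := riesz_extension C ⟨LinearMap.range a, L⟩
    (by
      rintro ⟨_, w, rfl⟩ hx
      exact (hpos w hx).trans_eq (hL w).symm)
    fun y => by
      obtain ⟨w, hw⟩ := hdense y
      exact ⟨a.rangeRestrict w, hw⟩
  exact ⟨g, fun w => (hg (a.rangeRestrict w)).trans (hL w), hgC⟩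

theorem exists_dominated_extension (N : E → ℝ) (N_hom : ∀ c : ℝ, 0 < c → ∀ x, N (c • x) = c * N x)
    (N_add : ∀ x y, N (x + y) ≤ N x + N y) (a : W →ₗ[ℝ] E) (b : W →ₗ[ℝ] ℝ)
    (hb : ∀ w, b w ≤ N (a w)) :
    ∃ L : E →ₗ[ℝ] ℝ, (∀ w, L (a w) = b w) ∧ ∀ x, L x ≤ N x := by
  have N_zero : N 0 = 0 := by
    have := N_hom 2 two_pos 0
    rw [smul_zero] at this
    linarith
  obtain ⟨L, hL⟩ := exists_factor_range a b fun w hw => by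
    have h1 := hb w
    have h2 := hb (-w)
    rw [map_neg, map_neg, hw, neg_zero] at h2
    rw [hw] at h1
    linarith
  obtain ⟨g, hg, hgN⟩ := exists_extension_of_le_sublinear ⟨LinearMap.range a, L⟩ N N_hom N_add
    (by
      rintro ⟨_, w, rfl⟩
      exact (hL w).trans_le (hb w))
  exact ⟨g, fun w => (hg (a.rangeRestrict w)).trans (hL w), hgN⟩

end Extension

/-! ### Invariant means and invariant integrals -/

section Mean

variable {G : Type u} [Group G]

/-- A left-invariant mean on bounded functions, extended arbitrarily to all functions. -/
structure IsInvariantMean (m : (G → ℝ) → ℝ) : Prop where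
  add : ∀ F F' : G → ℝ, IsBoundedFun F → IsBoundedFun F' → m (F + F') = m F + m F'
  smul : ∀ (c : ℝ) (F : G → ℝ), IsBoundedFun F → m (c • F) = c * m F
  nonneg : ∀ F : G → ℝ, IsBoundedFun F → 0 ≤ F → 0 ≤ m F
  one : m 1 = 1
  invariant : ∀ (g : G) (F : G → ℝ), IsBoundedFun F → m (fun x => F (g⁻¹ * x)) = m F

theorem IsBoundedFun.add {X : Type*} {F F' : X → ℝ} (h : IsBoundedFun F) (h' : IsBoundedFun F') :
    IsBoundedFun (F + F') := by
  obtain ⟨M, hM⟩ := h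
  obtain ⟨M', hM'⟩ := h'
  exact ⟨M + M', fun x => (abs_add_le _ _).trans (add_le_add (hM x) (hM' x))⟩

theorem IsBoundedFun.smul {X : Type*} {F : X → ℝ} (h : IsBoundedFun F) (c : ℝ) :
    IsBoundedFun (c • F) := by
  obtain ⟨M, hM⟩ := h
  refine ⟨|c| * M, fun x => ?_⟩
  rw [Pi.smul_apply, smul_eq_mul, abs_mul]
  exact mul_le_mul_of_nonneg_left (hM x) (abs_nonneg c)

theorem IsBoundedFun.translate {F : G → ℝ} (h : IsBoundedFun F) (g : G) :
    IsBoundedFun fun x => F (g⁻¹ * x) := by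
  obtain ⟨M, hM⟩ := h
  exact ⟨M, fun x => hM _⟩

theorem TranslateProperty.exists_invariantMean (h : TranslateProperty G) :
    ∃ m : (G → ℝ) → ℝ, IsInvariantMean m := by
  classical
  have hex (i : Finset G × ℕ) := h.exists_almost_invariant i.1 (ε := 1 / ((i.2 : ℝ) + 1))
    (by positivity)
  choose u hfin hu0 hu1 hu using hex
  let U : Ultrafilter (Finset G × ℕ) := Ultrafilter.of Filter.atTop
  have hU : (U : Filter (Finset G × ℕ)) ≤ Filter.atTop := Ultrafilter.of_le _
  let A (F : G → ℝ) (i : Finset G × ℕ) : ℝ := ∑' x, u i x * F x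
  have hs (F : G → ℝ) (i : Finset G × ℕ) : Summable fun x => u i x * F x :=
    summable_of_hasFiniteSupport ((hfin i).subset fun x hx hx' => hx (by simp [hx']))
  have hsu (i : Finset G × ℕ) : Summable (u i) := summable_of_hasFiniteSupport (hfin i)
  have hbound (v F : G → ℝ) (hv : Summable v) (hv0 : 0 ≤ v) (M : ℝ) (hM : ∀ x, |F x| ≤ M)
      (w : G → ℝ) (hw : ∀ x, |w x| ≤ v x) : |∑' x, w x * F x| ≤ M * ∑' x, v x := by
    rw [← tsum_mul_left]
    have hle (x : G) : ‖w x * F x‖ ≤ M * v x := by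
      rw [Real.norm_eq_abs, abs_mul, mul_comm]
      exact mul_le_mul (hM x) (hw x) (abs_nonneg _) ((abs_nonneg _).trans (hM x))
    exact tsum_of_norm_bounded (hv.mul_left M).hasSum hle
  have hlim (F : G → ℝ) (hF : IsBoundedFun F) : ∃ L, Filter.Tendsto (A F) U (nhds L) := by
    obtain ⟨M, hM⟩ := hF
    have hA (i : Finset G × ℕ) : A F i ∈ Set.Icc (-M) M := by
      have := hbound (u i) F (hsu i) (hu0 i) M hM (u i) fun x => (abs_of_nonneg (hu0 i x)).le
      rw [hu1, mul_one] at this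
      exact abs_le.1 this
    obtain ⟨L, -, hL⟩ := (isCompact_Icc (a := -M) (b := M)).ultrafilter_le_nhds' (U.map (A F))
      (Ultrafilter.mem_map.2 (Filter.univ_mem' hA : _ ∈ (U : Filter _)))
    exact ⟨L, hL⟩
  choose! m hm using hlim
  have bone : IsBoundedFun (1 : G → ℝ) := ⟨1, fun x => by simp⟩
  refine ⟨m, ⟨fun F F' hF hF' => ?_, fun c F hF => ?_, fun F hF hF0 => ?_, ?_, fun g F hF => ?_⟩⟩
  · refine tendsto_nhds_unique (hm _ (hF.add hF')) (((hm _ hF).add (hm _ hF')).congr fun i => ?_)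
    simp only [A]
    rw [← Summable.tsum_add (hs _ i) (hs _ i)]
    exact tsum_congr fun x => by rw [Pi.add_apply]; ring
  · refine tendsto_nhds_unique (hm _ (hF.smul c)) (((hm _ hF).const_mul c).congr fun i => ?_)
    simp only [A]
    rw [← tsum_mul_left]
    exact tsum_congr fun x => by rw [Pi.smul_apply, smul_eq_mul]; ring
  · exact ge_of_tendsto' (hm _ hF) fun i => tsum_nonneg fun x => mul_nonneg (hu0 i x) (hF0 x)
  · refine tendsto_nhds_unique (hm _ bone) (tendsto_const_nhds.congr fun i => ?_)
    simp [A, hu1]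
  · refine tendsto_nhds_unique (hm _ (hF.translate g)) ?_
    have hdiff : Filter.Tendsto (fun i => A (fun x => F (g⁻¹ * x)) i - A F i) U (nhds 0) := by
      obtain ⟨M, hM⟩ := hF
      have hM0 : 0 ≤ M := (abs_nonneg _).trans (hM 1)
      have hz : Filter.Tendsto (fun i : Finset G × ℕ => M * (1 / ((i.2 : ℝ) + 1))) U (nhds 0) := by
        have h1 : Filter.Tendsto (fun i : Finset G × ℕ => i.2) Filter.atTop Filter.atTop := by
          rw [← Filter.prod_atTop_atTop_eq]
          exact Filter.tendsto_snd
        have h2 := (tendsto_one_div_add_atTop_nhds_zero_nat (𝕜 := ℝ)).comp (h1.mono_left hU)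
        simpa using h2.const_mul M
      refine squeeze_zero_norm' ?_ hz
      -- Moving the translation from `F` onto `u i` inverts it, so almost invariance is needed at
      -- `g⁻¹`.
      have hev : ∀ᶠ i in (U : Filter (Finset G × ℕ)), g⁻¹ ∈ i.1 :=
        hU ((Filter.eventually_ge_atTop ({g⁻¹}, 0)).mono fun i hi => hi.1 (by simp))
      filter_upwards [hev] with i hi
      have h1 : A (fun x => F (g⁻¹ * x)) i - A F i
          = ∑' x, (u i ((g⁻¹)⁻¹ * x) - u i x) * F x := by
        have h2 : A (fun x => F (g⁻¹ * x)) i = ∑' x, u i ((g⁻¹)⁻¹ * x) * F x := by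
          rw [← tsum_translate (fun x => u i ((g⁻¹)⁻¹ * x) * F x) g]
          exact tsum_congr fun x => by simp
        rw [h2]
        simp only [A]
        rw [← Summable.tsum_sub _ (hs _ i)]
        · exact tsum_congr fun x => by ring
        · exact summable_of_hasFiniteSupport ((support_translate_finite (hfin i) g⁻¹).subset
            fun x hx hx' => hx (by simp only [hx', zero_mul]))
      rw [h1, Real.norm_eq_abs]
      have hsum : Summable fun x => |u i ((g⁻¹)⁻¹ * x) - u i x| :=
        ((summable_of_hasFiniteSupport (support_translate_finite (hfin i) g⁻¹)).sub (hsu i)).abs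
      refine (hbound _ F hsum (fun x => abs_nonneg _) M hM _ fun x => le_rfl).trans ?_
      gcongr
      exact (hu i _ hi).le
    simpa using hdiff.add (hm _ hF)

/-- The action of `G` on `ℓ^∞(G; f)` by left translation. -/
def ellInfTranslate (f : G → ℝ) (g : G) : ellInf f →ₗ[ℝ] ellInf f :=
  (leftTranslation G g).restrict fun _ hh => translate_mem_ellInf g hh

@[simp] theorem coe_ellInfTranslate (f : G → ℝ) (g : G) (h : ellInf f) (x : G) :
    (ellInfTranslate f g h : G → ℝ) x = (h : G → ℝ) (g⁻¹ * x) := rfl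

theorem ellInfTranslate_mul (f : G → ℝ) (g g' : G) (h : ellInf f) :
    ellInfTranslate f (g * g') h = ellInfTranslate f g (ellInfTranslate f g' h) :=
  Subtype.ext <| funext fun x => by simp [mul_assoc]

theorem TranslateProperty.exists_positive_form (h : TranslateProperty G) {f : G → ℝ} (hf : 0 ≤ f)
    (hf0 : f ≠ 0) (hb : IsBoundedFun f) :
    ∃ μ : ellInf f →ₗ[ℝ] ℝ, (∀ k : ellInf f, 0 ≤ (k : G → ℝ) → 0 ≤ μ k) ∧
      ∀ g, μ (ellInfTranslate f g ⟨f, self_mem_ellInf hf⟩) = 1 := by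
  let C : PointedCone ℝ (ellInf f) :=
    { carrier := {k | 0 ≤ (k : G → ℝ)}
      zero_mem' := le_refl (0 : G → ℝ)
      add_mem' := fun ha hb => add_nonneg (α := G → ℝ) ha hb
      smul_mem' := fun c _ ha x => mul_nonneg c.2 (ha x) }
  let a : (G →₀ ℝ) →ₗ[ℝ] ellInf f :=
    Finsupp.linearCombination ℝ fun g => ellInfTranslate f g ⟨f, self_mem_ellInf hf⟩
  let b : (G →₀ ℝ) →ₗ[ℝ] ℝ := Finsupp.linearCombination ℝ fun _ => 1
  have ha (c : G →₀ ℝ) (x : G) : (a c : G → ℝ) x = ∑ g : c.support, c g * f ((g : G)⁻¹ * x) := by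
    rw [Finset.sum_coe_sort c.support fun g => c g * f (g⁻¹ * x)]
    simp [a, Finsupp.linearCombination_apply, Finsupp.sum]
  have hb' (c : G →₀ ℝ) : b c = ∑ g : c.support, c g := by
    rw [Finset.sum_coe_sort c.support fun g => c g]
    simp [b, Finsupp.linearCombination_apply, Finsupp.sum]
  obtain ⟨L, hL, hpos⟩ := exists_positive_extension C a b
    (fun c hc => by
      rw [hb']
      exact h.fintype hf hf0 hb _ _ fun x => (hc x).trans_eq (ha c x))
    fun k => by
      obtain ⟨n, g, hg⟩ := (gDominates_iff f k).1 k.2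
      refine ⟨∑ i, Finsupp.single (g i) 1, fun x => ?_⟩
      have h1 := (abs_le.1 (hg x)).1
      have h2 : (a (∑ i, Finsupp.single (g i) 1) : G → ℝ) x = ∑ i, f ((g i)⁻¹ * x) := by
        simp [a]
      change 0 ≤ (a (∑ i, Finsupp.single (g i) 1) : G → ℝ) x + (k : G → ℝ) x
      linarith
  refine ⟨L, hpos, fun g => ?_⟩
  have := hL (Finsupp.single g 1)
  simpa [a, b] using this

/-- The integral of `k` is the mean of `g ↦ ν (g⁻¹ k)`. This function is bounded: `k` is dominated
by `n` translates of `f`, on each of which `ν` is `1`. For `k = f` it is constantly `1`. -/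
theorem TranslateProperty.exists_isIntegral (h : TranslateProperty G) {f : G → ℝ} (hf : 0 ≤ f)
    (hf0 : f ≠ 0) (hb : IsBoundedFun f) : ∃ μ : ellInf f →ₗ[ℝ] ℝ, IsIntegral f hf μ := by
  obtain ⟨ν, hν, hν1⟩ := h.exists_positive_form hf hf0 hb
  obtain ⟨m, hm⟩ := h.exists_invariantMean
  let F (k : ellInf f) (g : G) : ℝ := ν (ellInfTranslate f g⁻¹ k)
  have hF (k : ellInf f) : IsBoundedFun (F k) := by
    obtain ⟨n, a, ha⟩ := (gDominates_iff f k).1 k.2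
    refine ⟨n, fun g => ?_⟩
    let s : ellInf f := ∑ i, ellInfTranslate f (g⁻¹ * a i) ⟨f, self_mem_ellInf hf⟩
    have hs : ν s = n := by simp [s, hν1]
    have hs' (x : G) : (s : G → ℝ) x = ∑ i, f ((a i)⁻¹ * (g * x)) := by simp [s, mul_assoc]
    have h1 : 0 ≤ ν (s - ellInfTranslate f g⁻¹ k) := hν _ fun x => by
      have := (abs_le.1 (ha (g * x))).2
      simp [hs']
      linarith
    have h2 : 0 ≤ ν (s + ellInfTranslate f g⁻¹ k) := hν _ fun x => by
      have := (abs_le.1 (ha (g * x))).1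
      simp [hs']
      linarith
    rw [map_sub, hs] at h1
    rw [map_add, hs] at h2
    exact abs_le.2 ⟨by linarith, by linarith⟩
  refine ⟨{ toFun := fun k => m (F k), map_add' := fun k l => ?_, map_smul' := fun c k => ?_ },
    ⟨fun k hk => ?_, fun g k => ?_, ?_⟩⟩
  · rw [← hm.add _ _ (hF k) (hF l)]
    exact congrArg m (funext fun g => by simp [F])
  · rw [RingHom.id_apply, smul_eq_mul, ← hm.smul _ _ (hF k)]
    exact congrArg m (funext fun g => by simp [F])
  · exact hm.nonneg _ (hF k) fun g => hν _ fun x => hk (g⁻¹⁻¹ * x)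
  · refine Eq.trans (congrArg m (funext fun x => ?_)) (hm.invariant g _ (hF k))
    change ν (ellInfTranslate f x⁻¹ (ellInfTranslate f g k)) = ν (ellInfTranslate f (g⁻¹ * x)⁻¹ k)
    rw [← ellInfTranslate_mul, mul_inv_rev, inv_inv]
  · refine Eq.trans (congrArg m (funext fun x => ?_)) hm.one
    exact hν1 _

end Mean

/-! ### The Reiter property -/

section Reiter

/-- The weighted `ℓ¹`-norm of a finitely supported function. -/
noncomputable def weightedNorm {X : Type*} (f : X → ℝ) (u : X →₀ ℝ) : ℝ := l1Norm (⇑u * f)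

theorem summable_abs_mul {X : Type*} (f : X → ℝ) (u : X →₀ ℝ) : Summable fun x => |(⇑u * f) x| :=
  summable_of_hasFiniteSupport (u.hasFiniteSupport.subset fun x hx hx' => hx (by simp [hx']))

theorem weightedNorm_smul {X : Type*} (f : X → ℝ) {c : ℝ} (hc : 0 < c) (u : X →₀ ℝ) :
    weightedNorm f (c • u) = c * weightedNorm f u := by
  simp only [weightedNorm, l1Norm]
  rw [← tsum_mul_left]
  refine tsum_congr fun x => ?_
  simp [abs_mul, abs_of_pos hc, mul_assoc]

theorem weightedNorm_add_le {X : Type*} (f : X → ℝ) (u v : X →₀ ℝ) :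
    weightedNorm f (u + v) ≤ weightedNorm f u + weightedNorm f v := by
  simp only [weightedNorm, l1Norm]
  rw [← Summable.tsum_add (summable_abs_mul f u) (summable_abs_mul f v)]
  refine Summable.tsum_le_tsum (fun x => ?_) (summable_abs_mul f _)
    ((summable_abs_mul f u).add (summable_abs_mul f v))
  simpa [add_mul] using abs_add_le (u x * f x) (v x * f x)

theorem weightedNorm_nonneg {X : Type*} (f : X → ℝ) (u : X →₀ ℝ) : 0 ≤ weightedNorm f u :=
  tsum_nonneg fun _ => abs_nonneg _

@[simp] theorem weightedNorm_zero {X : Type*} (f : X → ℝ) : weightedNorm f 0 = 0 := by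
  simp [weightedNorm, l1Norm]

theorem weightedNorm_single {X : Type*} (f : X → ℝ) (x : X) (c : ℝ) :
    weightedNorm f (Finsupp.single x c) = |c * f x| := by
  rw [weightedNorm, l1Norm, tsum_eq_single x]
  · simp
  · intro y hy
    simp [Finsupp.single_eq_of_ne hy]

theorem linearCombination_abs_le_weightedNorm {X : Type*} (f : X → ℝ) (u : X →₀ ℝ) :
    Finsupp.linearCombination ℝ (fun x => |f x|) u ≤ weightedNorm f u := by
  rw [weightedNorm, l1Norm, tsum_eq_sum (s := u.support)
    fun x hx => by simp [Finsupp.notMem_support_iff.1 hx], Finsupp.linearCombination_apply]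
  refine Finset.sum_le_sum fun x _ => ?_
  simp only [smul_eq_mul, Pi.mul_apply, abs_mul]
  exact mul_le_mul_of_nonneg_right (le_abs_self _) (abs_nonneg _)

variable {G : Type u} [Group G]

/-- An invariant integral on `ℓ^∞(G; |f|)` implies the `f`-Reiter property. -/
theorem IsIntegral.reiterProperty {f : G → ℝ} {μ : ellInf (fun x => |f x|) →ₗ[ℝ] ℝ}
    (hf : 0 ≤ fun x => |f x|) (hμ : IsIntegral (fun x => |f x|) hf μ) : ReiterProperty f := by
  classical
  intro S ε hε
  by_contra! H
  let a : (G →₀ ℝ) →ₗ[ℝ] (S → G →₀ ℝ) :=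
    LinearMap.pi fun s => (Finsupp.domLCongr (Equiv.mulLeft (s : G))).toLinearMap - LinearMap.id
  let b : (G →₀ ℝ) →ₗ[ℝ] ℝ := ε • Finsupp.linearCombination ℝ fun x => |f x|
  have ha (u : G →₀ ℝ) (s : S) : ⇑(a u s) = leftTranslation G s ⇑u - ⇑u := by
    ext x
    simp [a, leftTranslation_apply]
  -- Failure of Reiter's condition bounds `ε ∑ u |f|` by the weighted norm of the tuple `(s u -
  -- u)_s`, so this form factors through the tuples and extends to all of them under the same bound.
  obtain ⟨L, hL, hLN⟩ := exists_dominated_extension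
    (fun w : S → G →₀ ℝ => ∑ s, weightedNorm f (w s))
    (fun c hc w => by simp [weightedNorm_smul f hc, Finset.mul_sum])
    (fun w w' => by
      rw [← Finset.sum_add_distrib]
      exact Finset.sum_le_sum fun s _ => weightedNorm_add_le f _ _)
    a b fun u => by
      obtain ⟨s, hs, hle⟩ := H u
      calc b u ≤ ε * weightedNorm f u :=
            mul_le_mul_of_nonneg_left (linearCombination_abs_le_weightedNorm f u) hε.le
        _ ≤ weightedNorm f (a u ⟨s, hs⟩) := by rw [weightedNorm, weightedNorm, ha]; exact hle
        _ ≤ _ := Finset.single_le_sum (f := fun s => weightedNorm f (a u s))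
            (fun s _ => weightedNorm_nonneg f _) (Finset.mem_univ _)
  have hLs (s : S) (x : G) (c : ℝ) : L (Pi.single s (Finsupp.single x c)) ≤ |c * f x| := by
    refine (hLN _).trans_eq ?_
    rw [Finset.sum_eq_single s]
    · rw [Pi.single_eq_same, weightedNorm_single]
    · intro s' _ hs'
      rw [Pi.single_eq_of_ne hs', weightedNorm_zero]
    · simp
  let k (s : S) : ellInf fun x => |f x| :=
    ⟨fun x => L (Pi.single s (Finsupp.single x 1)),
      (gDominates_iff _ _).2 ⟨1, fun _ => 1, fun x => by
        have h1 := hLs s x 1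
        have h2 := hLs s x (-1)
        rw [Finsupp.single_neg, Pi.single_neg, map_neg] at h2
        simp at h1 h2
        simpa using abs_le.2 ⟨by linarith, h1⟩⟩⟩
  -- The identity `L ∘ a = b` read on point masses: `ε |f|` is a sum of coboundaries of functions `k
  -- s` with `|k s| ≤ |f|`. An invariant integral kills the right side but not the left.
  have key : ε • (⟨_, self_mem_ellInf hf⟩ : ellInf fun x => |f x|)
      = ∑ s : S, (ellInfTranslate _ (s : G)⁻¹ (k s) - k s) := by
    refine Subtype.ext (funext fun x => ?_)
    have h1 := hL (Finsupp.single x 1)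
    have h2 : a (Finsupp.single x 1) = ∑ s : S,
        (Pi.single s (Finsupp.single ((s : G) * x) 1) - Pi.single s (Finsupp.single x 1)) := by
      rw [← Finset.univ_sum_single (a (Finsupp.single x 1))]
      refine Finset.sum_congr rfl fun s _ => ?_
      rw [← Pi.single_sub]
      congr 1
      simp [a]
    rw [h2, map_sum] at h1
    simp only [map_sub] at h1
    simp only [Submodule.coe_smul, Pi.smul_apply, smul_eq_mul, Submodule.coe_sum, Finset.sum_apply,
      Submodule.coe_sub, Pi.sub_apply, coe_ellInfTranslate, inv_inv]
    rw [h1]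
    simp [b]
  have h3 := congrArg μ key
  rw [map_smul, hμ.normalised, map_sum] at h3
  have h4 (s : S) : μ (ellInfTranslate _ (s : G)⁻¹ (k s) - k s) = 0 := by
    rw [map_sub, sub_eq_zero]
    exact hμ.invariant (s : G)⁻¹ (k s)
  simp [h4] at h3
  exact hε.ne' h3

/-- Pair the non-negative combination with `|u|`. Each translate of `f` pairs to `c = ‖u f‖₁` up to
`ε c`, so the result is within `ε c ∑ |t i|` of `c ∑ t i`. -/
theorem ReiterProperty.sum_nonneg {f : G → ℝ} (h : ReiterProperty f) (hf : 0 ≤ f) {n : ℕ}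
    (t : Fin n → ℝ) (g : Fin n → G) (hs : 0 ≤ ∑ i, t i • leftTranslation G (g i) f) :
    0 ≤ ∑ i, t i := by
  classical
  by_contra! hneg
  have hA : 0 ≤ ∑ i, |t i| := Finset.sum_nonneg fun i _ => abs_nonneg _
  set ε : ℝ := -(∑ i, t i) / (∑ i, |t i| + 1) with hεdef
  have hε : 0 < ε := div_pos (neg_pos.2 hneg) (by linarith)
  -- At `s = 1` the strict Reiter inequality forces `‖u f‖₁ > 0`.
  obtain ⟨u, hu⟩ := h (insert 1 (Finset.univ.image fun i => (g i)⁻¹)) ε hε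
  set c := l1Norm (⇑u * f) with hc
  have hcpos : 0 < c := by
    have h1 := hu 1 (Finset.mem_insert_self _ _)
    have h2 : 0 ≤ l1Norm ((leftTranslation G 1 ⇑u - ⇑u) * f) := tsum_nonneg fun _ => abs_nonneg _
    exact pos_of_mul_pos_right (h2.trans_lt h1) hε.le
  have hcabs : c = ∑' x, |u x| * f x :=
    tsum_congr fun x => by rw [Pi.mul_apply, abs_mul, abs_of_nonneg (hf x)]
  have hfin : (Function.support fun x => |u x|).Finite :=
    u.hasFiniteSupport.subset fun x hx hx' => hx (by simp [hx'])
  have hsum {v : G → ℝ} (hv : v.support.Finite) (k : G → ℝ) : Summable fun x => v x * k x :=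
    summable_of_hasFiniteSupport (hv.subset fun x hx hx' => hx (by simp [hx']))
  have htr (i : Fin n) : |∑' x, |u x| * f ((g i)⁻¹ * x) - c| ≤ ε * c := by
    have h1 : ∑' x, |u x| * f ((g i)⁻¹ * x) = ∑' x, |u (((g i)⁻¹)⁻¹ * x)| * f x := by
      rw [← tsum_translate (fun x => |u (((g i)⁻¹)⁻¹ * x)| * f x) (g i)]
      exact tsum_congr fun x => by simp
    have hfin' := support_translate_finite hfin (g i)⁻¹
    rw [h1, hcabs, ← Summable.tsum_sub (hsum hfin' f) (hsum hfin f), ← hcabs]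
    refine le_trans ?_
      (hu (g i)⁻¹ (Finset.mem_insert_of_mem (Finset.mem_image_of_mem _ (Finset.mem_univ i)))).le
    rw [← Real.norm_eq_abs]
    refine tsum_of_norm_bounded (Summable.hasSum ?_) fun x => ?_
    · have h2 := (hsum hfin' f).add (hsum hfin f)
      refine h2.of_nonneg_of_le (fun x => abs_nonneg _) fun x => ?_
      rw [Pi.mul_apply, abs_mul, abs_of_nonneg (hf x), ← add_mul]
      exact mul_le_mul_of_nonneg_right (abs_sub _ _) (hf x)
    · rw [Real.norm_eq_abs, ← sub_mul, Pi.mul_apply, abs_mul, abs_mul]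
      exact mul_le_mul_of_nonneg_right (abs_abs_sub_abs_le_abs_sub _ _) (abs_nonneg _)
  have hpos : 0 ≤ ∑ i, t i * ∑' x, |u x| * f ((g i)⁻¹ * x) := by
    have h1 : ∑ i, t i * ∑' x, |u x| * f ((g i)⁻¹ * x)
        = ∑' x, |u x| * (∑ i, t i • leftTranslation G (g i) f) x := by
      simp only [← tsum_mul_left]
      rw [← Summable.tsum_finsetSum fun i _ => (hsum hfin _).mul_left _]
      refine tsum_congr fun x => ?_
      simp only [Finset.sum_apply, Pi.smul_apply, smul_eq_mul, leftTranslation_apply,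
        Finset.mul_sum]
      exact Finset.sum_congr rfl fun i _ => by ring
    rw [h1]
    exact tsum_nonneg fun x => mul_nonneg (abs_nonneg _) (hs x)
  have hle : ∑ i, t i * ∑' x, |u x| * f ((g i)⁻¹ * x) ≤ ∑ i, (t i * c + |t i| * (ε * c)) := by
    refine Finset.sum_le_sum fun i _ => ?_
    have h1 := (le_abs_self _).trans
      ((abs_mul (t i) _).trans_le (mul_le_mul_of_nonneg_left (htr i) (abs_nonneg (t i))))
    rw [mul_sub] at h1
    linarith
  rw [Finset.sum_add_distrib, ← Finset.sum_mul, ← Finset.sum_mul] at hle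
  have h1 : (∑ i, |t i|) * (ε * c) + ε * c = -(∑ i, t i) * c := by
    rw [← add_one_mul, ← mul_assoc, hεdef, mul_div_cancel₀ _ (by linarith)]
  have h2 : 0 < ε * c := by positivity
  linarith

end Reiter

/-! ### The abstract translate property -/

section Abstract

variable (G : Type u) [Group G]

/-- The orbit function `x ↦ δ (x⁻¹ v)` transports the inequality from `V` to bounded functions on
`G`. -/
theorem TranslateProperty.abstractTranslateProperty (h : TranslateProperty G) :
    AbstractTranslateProperty.{u, w} G := by
  intro V _ _ _ _ _ ρ hρ v hv hδ n t g hs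
  obtain ⟨δ, hδ, hδv, M, hM⟩ := hδ
  have pos (x : G) {y : V} (hy : 0 ≤ y) : 0 ≤ δ (ρ x y) :=
    hδ _ ((map_zero (ρ x)).symm.trans_le (hρ x hy))
  refine h (fun x => δ (ρ x⁻¹ v)) (fun x => pos _ hv) (fun h0 => hδv ?_) ⟨M, fun x => hM _⟩ n t g
    fun x => ?_
  · simpa using congrFun h0 1
  · have := pos x⁻¹ hs
    simpa [leftTranslation_apply] using this

/-- Left translation on functions on `ULift G`. -/
def uliftTranslation : Representation ℝ G (ULift.{w} G → ℝ) where
  toFun g :=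
    { toFun := fun f x => f ⟨g⁻¹ * x.down⟩
      map_add' := fun _ _ => rfl
      map_smul' := fun _ _ => rfl }
  map_one' := by
    ext f x
    simp
  map_mul' g h := by
    refine LinearMap.ext fun f => funext fun x => ?_
    simp [mul_assoc]

theorem AbstractTranslateProperty.translateProperty
    (h : AbstractTranslateProperty.{u, max u w} G) : TranslateProperty G := by
  intro f hf hf0 hb n t g hs
  obtain ⟨M, hM⟩ := hb
  obtain ⟨x, hx⟩ := Function.ne_iff.1 hf0
  have : IsOrderedModule ℝ (ULift.{w} G → ℝ) :=
    { smul_le_smul_of_nonneg_left := fun c hc k l hkl x => mul_le_mul_of_nonneg_left (hkl x) hc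
      smul_le_smul_of_nonneg_right := fun k hk c d hcd x =>
        mul_le_mul_of_nonneg_right hcd (hk x) }
  have mono (g : G) : Monotone (uliftTranslation.{u, w} G g) :=
    fun k l hkl x => hkl ⟨g⁻¹ * x.down⟩
  refine h (ULift.{w} G → ℝ) (uliftTranslation G) mono (fun y => f y.down) (fun y => hf _)
    ⟨LinearMap.proj (R := ℝ) (φ := fun _ : ULift.{w} G => ℝ) ⟨x⟩, fun k hk => hk ⟨x⟩, hx, M,
      fun g => hM (g⁻¹ * x)⟩ n t g fun y => ?_
  have := hs y.down
  simpa [uliftTranslation, leftTranslation_apply] using this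

end Abstract

/-! ### Weakly complete cones -/

section WeakCompleteness

variable {E : Type v} [AddCommGroup E] [Module ℝ E] [TopologicalSpace E]

/-- The evaluation map of a topological vector space into the functions on its dual. -/
def evalDual (E : Type v) [AddCommGroup E] [Module ℝ E] [TopologicalSpace E] :
    E →ₗ[ℝ] ((E →L[ℝ] ℝ) → ℝ) where
  toFun x l := l x
  map_add' x y := funext fun l => map_add l x y
  map_smul' c x := funext fun l => map_smul l c x

theorem exists_form_of_continuous_pi (Λ : (E →L[ℝ] ℝ) →ₗ[ℝ] ℝ)
    (Ψ : ((E →L[ℝ] ℝ) → ℝ) →L[ℝ] ℝ) :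
    ∃ l : E →L[ℝ] ℝ, (∀ x, Ψ (evalDual E x) = l x) ∧ Ψ Λ = Λ l := by
  have hΨ : (Ψ : ((E →L[ℝ] ℝ) → ℝ) →ₗ[ℝ] ℝ) ∈ Submodule.span ℝ
      (Set.range fun l : E →L[ℝ] ℝ => LinearMap.proj (R := ℝ) (φ := fun _ => ℝ) l) :=
    (LinearMap.mem_span_iff_continuous _).2 Ψ.continuous
  suffices H : ∀ ψ ∈ Submodule.span ℝ
      (Set.range fun l : E →L[ℝ] ℝ => LinearMap.proj (R := ℝ) (φ := fun _ => ℝ) l),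
      ∃ l : E →L[ℝ] ℝ, (∀ x, ψ (evalDual E x) = l x) ∧ ψ Λ = Λ l from H _ hΨ
  intro ψ hψ
  induction hψ using Submodule.span_induction with
  | mem _ h =>
    obtain ⟨l, rfl⟩ := h
    exact ⟨l, fun x => rfl, rfl⟩
  | zero => exact ⟨0, fun x => rfl, (map_zero Λ).symm⟩
  | add ψ ψ' _ _ h h' =>
    obtain ⟨l, hl, hlΛ⟩ := h
    obtain ⟨l', hl', hlΛ'⟩ := h'
    exact ⟨l + l', fun x => by simp [hl, hl'], by simp [hlΛ, hlΛ']⟩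
  | smul c ψ _ h =>
    obtain ⟨l, hl, hlΛ⟩ := h
    exact ⟨c • l, fun x => by simp [hl], by simp [hlΛ]⟩

/-- The weak uniformity is pulled back from the product `ℝ^{E'}`, which is complete and Hausdorff,
so completeness of the cone is closedness of its image. -/
theorem isWeaklyComplete_iff (C : ConvexCone ℝ E) :
    IsWeaklyComplete C ↔ IsClosed (evalDual E '' (C : Set E)) := by
  let U : UniformSpace (WeakSpace ℝ E) := IsTopologicalAddGroup.rightUniformSpace (WeakSpace ℝ E)
  have : IsUniformAddGroup (WeakSpace ℝ E) := isUniformAddGroup_of_addCommGroup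
  let J : WeakSpace ℝ E →+ ((E →L[ℝ] ℝ) → ℝ) :=
    ((evalDual E).comp (toWeakSpace ℝ E).symm.toLinearMap).toAddMonoidHom
  have hJ : Topology.IsInducing J := ⟨rfl⟩
  have hJ' : IsUniformInducing J := AddMonoidHom.isUniformInducing_of_isInducing hJ
  have himage : J '' (toWeakSpace ℝ E '' (C : Set E)) = evalDual E '' (C : Set E) := by
    rw [Set.image_image]
    rfl
  have h1 : IsComplete (evalDual E '' (C : Set E)) ↔ IsClosed (evalDual E '' (C : Set E)) :=
    ⟨IsComplete.isClosed, IsClosed.isComplete⟩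
  rw [← h1, ← himage, hJ'.isComplete_iff]
  rfl

/-- A positive linear form on the dual of a space with a weakly complete cone is represented by a
point of the cone. -/
theorem IsWeaklyComplete.exists_mem_eq {C : ConvexCone ℝ E} (hC : IsWeaklyComplete C)
    (h0 : (0 : E) ∈ C) (Λ : (E →L[ℝ] ℝ) →ₗ[ℝ] ℝ)
    (hΛ : ∀ l : E →L[ℝ] ℝ, (∀ x ∈ C, 0 ≤ l x) → 0 ≤ Λ l) : ∃ y ∈ C, ∀ l : E →L[ℝ] ℝ, l y = Λ l := by
  suffices H : (Λ : (E →L[ℝ] ℝ) → ℝ) ∈ evalDual E '' (C : Set E) by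
    obtain ⟨y, hy, hyΛ⟩ := H
    exact ⟨y, hy, fun l => congrFun hyΛ l⟩
  by_contra hnot
  obtain ⟨Ψ, r, hr, hrΛ⟩ := geometric_hahn_banach_closed_point (C.convex.linear_image (evalDual E))
    ((isWeaklyComplete_iff C).1 hC) hnot
  obtain ⟨l, hl, hlΛ⟩ := exists_form_of_continuous_pi Λ Ψ
  have hlr (x : E) (hx : x ∈ C) : l x < r := (hl x).symm.trans_lt (hr _ ⟨x, hx, rfl⟩)
  have hr0 : 0 < r := by simpa using hlr 0 h0
  -- A form bounded above on a cone is non-positive there: otherwise scaling `x` by `r / l x`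
  -- reaches the value `r`.
  have hneg (x : E) (hx : x ∈ C) : 0 ≤ (-l) x := by
    by_contra! hlt
    have hpos : 0 < l x := by simpa using hlt
    have := hlr _ (C.smul_mem (div_pos hr0 hpos) hx)
    rw [map_smul, smul_eq_mul, div_mul_cancel₀ _ hpos.ne'] at this
    exact lt_irrefl _ this
  have := hΛ _ hneg
  rw [map_neg] at this
  linarith

end WeakCompleteness

/-! ### Fixed points in cones from invariant integrals -/

section FixedPoint

variable {G : Type u} [Group G]

theorem fixedPointPropertyForCones_of_isIntegral
    (h : ∀ (f : G → ℝ) (hf : 0 ≤ f), f ≠ 0 → IsBoundedFun f →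
      ∃ μ : ellInf f →ₗ[ℝ] ℝ, IsIntegral f hf μ) : FixedPointPropertyForCones.{u, v} G := by
  intro E _ _ _ _ _ _ _ C ρ hproper hcomplete hpres ⟨x, hxC, hx0, hbdd⟩ ⟨φ₀, hφ₀⟩
  have h0 : (0 : E) ∈ C := by
    have : (0 : E) ∈ (C : Set E) ∩ -(C : Set E) := by rw [hproper]; rfl
    exact this.1
  -- The given form `φ₀` need not be positive on `C`. It dominates itself, so some sum of its
  -- translates is at least `|φ₀|` on `C`; that sum is positive and still dominates everything.
  obtain ⟨φ, hφpos, hφ⟩ : ∃ φ : E →L[ℝ] ℝ, (∀ c ∈ C, 0 ≤ φ c) ∧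
      ∀ l : E →L[ℝ] ℝ, ∃ (n : ℕ) (g : Fin n → G), ∀ c ∈ C, |l c| ≤ ∑ i, φ (ρ (g i)⁻¹ c) := by
    have hdom (l : E →L[ℝ] ℝ) : ∃ (n : ℕ) (g : Fin n → G), ∀ c ∈ C,
        |l c| ≤ ∑ i, φ₀ (ρ (g i)⁻¹ c) := by
      obtain ⟨n, g, h1, h2⟩ := hφ₀ l
      refine ⟨n, g, fun c hc => abs_le'.2 ⟨(h1 c hc).trans_eq ?_, (h2 c hc).trans_eq ?_⟩⟩ <;>
      · rw [sum_apply]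
        rfl
    obtain ⟨n, g, hg⟩ := hdom φ₀
    refine ⟨∑ i, φ₀.comp (ρ (g i)⁻¹), fun c hc => ?_, fun l => ?_⟩
    · rw [sum_apply]
      exact (abs_nonneg _).trans (hg c hc)
    · obtain ⟨m, k, hk⟩ := hdom l
      refine ⟨m, k, fun c hc => (hk c hc).trans (Finset.sum_le_sum fun i _ => ?_)⟩
      rw [sum_apply]
      exact (le_abs_self _).trans (hg _ (hpres _ _ hc))
  have hmul (a b : G) (y : E) : ρ a (ρ b y) = ρ (a * b) y := by rw [map_mul]; rfl
  let T (l : E →L[ℝ] ℝ) (g : G) : ℝ := l (ρ g x)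
  have hTdom (l : E →L[ℝ] ℝ) : T l ∈ ellInf (T φ) := by
    obtain ⟨n, g, hg⟩ := hφ l
    refine (gDominates_iff _ _).2 ⟨n, g, fun a => (hg _ (hpres a x hxC)).trans_eq ?_⟩
    simp only [T, hmul]
  have hTpos : 0 ≤ T φ := fun g => hφpos _ (hpres g x hxC)
  have hTne : T φ ≠ 0 := fun hzero => by
    -- If `T φ` vanished, domination would make every continuous form vanish at `x`.
    obtain ⟨l, hl⟩ := SeparatingDual.exists_ne_zero (R := ℝ) hx0
    obtain ⟨n, g, hg⟩ := (gDominates_iff _ _).1 (hTdom l)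
    have := hg 1
    simp [hzero, T] at this
    exact hl this
  have hTb : IsBoundedFun (T φ) := by
    have h1 := (NormedSpace.isVonNBounded_iff ℝ).1 (hbdd.image φ)
    obtain ⟨M, hM⟩ := h1.exists_norm_le
    exact ⟨M, fun g => hM _ ⟨_, ⟨g, rfl⟩, rfl⟩⟩
  obtain ⟨μ, hμ⟩ := h (T φ) hTpos hTne hTb
  let Θ : (E →L[ℝ] ℝ) →ₗ[ℝ] ellInf (T φ) :=
    { toFun := fun l => ⟨T l, hTdom l⟩
      map_add' := fun _ _ => rfl
      map_smul' := fun _ _ => rfl }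
  obtain ⟨y, hyC, hy⟩ := hcomplete.exists_mem_eq h0 (μ.comp Θ) fun l hl =>
    hμ.nonneg _ fun g => hl _ (hpres g x hxC)
  refine ⟨y, hyC, fun hy0 => ?_, fun g => ?_⟩
  · have h1 : φ y = 1 := (hy φ).trans hμ.normalised
    rw [hy0, map_zero] at h1
    exact zero_ne_one h1
  · refine (SeparatingDual.eq_iff_forall_dual_eq (R := ℝ)).2 fun l => ?_
    change l.comp (ρ g) y = l y
    rw [hy, hy]
    refine Eq.trans (congrArg μ (Subtype.ext (funext fun a => ?_)))
      (hμ.invariant g⁻¹ ⟨T l, hTdom l⟩)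
    change l (ρ g (ρ a x)) = l (ρ (g⁻¹⁻¹ * a) x)
    rw [hmul, inv_inv]

/-! ### The universal cone: positive forms on `ℓ^∞(G; f)` -/

/-- The algebraic dual of `ℓ^∞(G; f)`, lifted to a larger universe. -/
def WeakStarDual (f : G → ℝ) : Type max u v := ULift.{v} (Module.Dual ℝ (ellInf f))

namespace WeakStarDual

variable {f : G → ℝ}

instance : AddCommGroup (WeakStarDual.{u, v} f) :=
  inferInstanceAs (AddCommGroup (ULift.{v} (Module.Dual ℝ (ellInf f))))

instance : Module ℝ (WeakStarDual.{u, v} f) :=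
  inferInstanceAs (Module ℝ (ULift.{v} (Module.Dual ℝ (ellInf f))))

/-- The linear form underlying a point of the weak-star dual. -/
def form : WeakStarDual.{u, v} f →ₗ[ℝ] Module.Dual ℝ (ellInf f) :=
  (ULift.moduleEquiv (R := ℝ) (M := Module.Dual ℝ (ellInf f))).toLinearMap

/-- The point of the weak-star dual given by a linear form. -/
def ofForm (l : Module.Dual ℝ (ellInf f)) : WeakStarDual.{u, v} f := ULift.up l

@[simp] theorem form_ofForm (l : Module.Dual ℝ (ellInf f)) : form (ofForm.{u, v} l) = l := rfl

theorem form_injective : Function.Injective (form : WeakStarDual.{u, v} f →ₗ[ℝ] _) :=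
  (ULift.moduleEquiv (R := ℝ) (M := Module.Dual ℝ (ellInf f))).injective

theorem ext_form {e e' : WeakStarDual.{u, v} f} (h : ∀ k, form e k = form e' k) : e = e' :=
  form_injective (LinearMap.ext h)

/-- The values of the linear form underlying a point of the weak-star dual. -/
def values (f : G → ℝ) : WeakStarDual.{u, v} f →ₗ[ℝ] (ellInf f → ℝ) :=
  (LinearMap.ltoFun ℝ (ellInf f) ℝ ℝ).comp form

/-- The weak-star topology. -/
instance : TopologicalSpace (WeakStarDual.{u, v} f) :=
  TopologicalSpace.induced (values f) inferInstance

instance : IsTopologicalAddGroup (WeakStarDual.{u, v} f) := topologicalAddGroup_induced (values f)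

instance : ContinuousSMul ℝ (WeakStarDual.{u, v} f) := continuousSMul_induced (values f)

instance : LocallyConvexSpace ℝ (WeakStarDual.{u, v} f) := LocallyConvexSpace.induced (values f)

theorem withSeminorms (f : G → ℝ) : WithSeminorms (SeminormFamily.comp
    (fun i : Σ _ : ellInf f, Fin 1 => (normSeminorm ℝ ℝ).comp (LinearMap.proj i.1))
    (values.{u, v} f)) :=
  LinearMap.withSeminorms_induced (withSeminorms_pi fun _ => norm_withSeminorms ℝ ℝ) (values f)

theorem continuous_form (k : ellInf f) : Continuous fun e : WeakStarDual.{u, v} f => form e k :=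
  (continuous_apply k).comp continuous_induced_dom

/-- Evaluation at an element of `ℓ^∞(G; f)`. -/
def eval (k : ellInf f) : WeakStarDual.{u, v} f →L[ℝ] ℝ where
  toLinearMap := (LinearMap.applyₗ k).comp form
  cont := continuous_form k

/-- A weak-star continuous form is a finite combination of evaluations, and evaluations are linear
in `k`. Domination in the dual thus reduces to domination by `f`. -/
theorem exists_eval_eq (l : WeakStarDual.{u, v} f →L[ℝ] ℝ) : ∃ k, eval k = l := by
  have h : (l : WeakStarDual.{u, v} f →ₗ[ℝ] ℝ) ∈ Submodule.span ℝ
      (Set.range fun k : ellInf f => (LinearMap.applyₗ k).comp form) := by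
    refine (LinearMap.mem_span_iff_continuous _).2 ?_
    rw [continuous_iff_le_induced]
    refine le_trans (le_of_eq ?_) l.continuous.le_induced
    exact (induced_to_pi (values f)).symm
  suffices H : ∀ ψ ∈ Submodule.span ℝ (Set.range fun k : ellInf f =>
      (LinearMap.applyₗ k).comp (form : WeakStarDual.{u, v} f →ₗ[ℝ] _)),
      ∃ k : ellInf f, ∀ e, form e k = ψ e by
    obtain ⟨k, hk⟩ := H _ h
    exact ⟨k, ContinuousLinearMap.ext hk⟩
  intro ψ hψ
  induction hψ using Submodule.span_induction with
  | mem _ h =>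
    obtain ⟨k, rfl⟩ := h
    exact ⟨k, fun e => rfl⟩
  | zero => exact ⟨0, fun e => map_zero _⟩
  | add ψ ψ' _ _ h h' =>
    obtain ⟨k, hk⟩ := h
    obtain ⟨k', hk'⟩ := h'
    exact ⟨k + k', fun e => by simp [hk, hk']⟩
  | smul c ψ _ h =>
    obtain ⟨k, hk⟩ := h
    exact ⟨c • k, fun e => by simp [hk]⟩

instance : T2Space (WeakStarDual.{u, v} f) :=
  (Function.Injective.isEmbedding_induced (f := values f)
    fun _ _ h => ext_form fun k => congrFun h k).t2Space

/-- The contragredient action of `G`. -/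
def action (f : G → ℝ) : G →* (WeakStarDual.{u, v} f →L[ℝ] WeakStarDual.{u, v} f) where
  toFun g :=
    { toFun := fun e => ofForm ((form e).comp (ellInfTranslate f g⁻¹))
      map_add' := fun _ _ => rfl
      map_smul' := fun _ _ => rfl
      cont := continuous_induced_rng.2 (continuous_pi fun k =>
        continuous_form (ellInfTranslate f g⁻¹ k)) }
  map_one' := by
    refine ContinuousLinearMap.ext fun e => ext_form fun k => ?_
    change form e (ellInfTranslate f 1⁻¹ k) = form e k
    congr 1
    exact Subtype.ext (funext fun x => by simp)
  map_mul' g g' := by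
    refine ContinuousLinearMap.ext fun e => ext_form fun k => ?_
    change form e (ellInfTranslate f (g * g')⁻¹ k)
      = form e (ellInfTranslate f g'⁻¹ (ellInfTranslate f g⁻¹ k))
    rw [← ellInfTranslate_mul, mul_inv_rev]

theorem form_action (g : G) (e : WeakStarDual.{u, v} f) (k : ellInf f) :
    form (action f g e) k = form e (ellInfTranslate f g⁻¹ k) := rfl

/-- The cone of positive linear forms. -/
def cone (f : G → ℝ) : ConvexCone ℝ (WeakStarDual.{u, v} f) where
  carrier := {e | ∀ k : ellInf f, 0 ≤ (k : G → ℝ) → 0 ≤ form e k}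
  smul_mem' c hc e he k hk := by
    rw [map_smul, LinearMap.smul_apply, smul_eq_mul]
    exact mul_nonneg hc.le (he k hk)
  add_mem' e he e' he' k hk := by
    rw [map_add, LinearMap.add_apply]
    exact add_nonneg (he k hk) (he' k hk)

theorem abs_form_le (hf : 0 ≤ f) (k : ellInf f) : ∃ (n : ℕ) (g : Fin n → G),
    ∀ e ∈ cone.{u, v} f,
      |form e k| ≤ ∑ i, form e (ellInfTranslate f (g i) ⟨f, self_mem_ellInf hf⟩) := by
  obtain ⟨n, g, hg⟩ := (gDominates_iff _ _).1 k.2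
  refine ⟨n, g, fun e he => ?_⟩
  rw [← map_sum]
  set s := ∑ i, ellInfTranslate f (g i) ⟨f, self_mem_ellInf hf⟩ with hs
  have hsx (x : G) : (s : G → ℝ) x = ∑ i, f ((g i)⁻¹ * x) := by simp [hs]
  have h1 := he (s - k) fun x => by
    have := (abs_le.1 (hg x)).2
    simp [hsx]
    linarith
  have h2 := he (s + k) fun x => by
    have := (abs_le.1 (hg x)).1
    simp [hsx]
    linarith
  rw [map_sub] at h1
  rw [map_add] at h2
  exact abs_le.2 ⟨by linarith, by linarith⟩

theorem isProperCone_cone (hf : 0 ≤ f) : IsProperCone (cone.{u, v} f) := by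
  refine Set.eq_singleton_iff_unique_mem.2 ⟨⟨?_, ?_⟩, fun e ⟨he, he'⟩ => ext_form fun k => ?_⟩
  · intro k _
    simp
  · intro k _
    simp
  · have hzero (k : ellInf f) (hk : 0 ≤ (k : G → ℝ)) : form e k = 0 := by
      have h1 := he' k hk
      rw [map_neg, LinearMap.neg_apply] at h1
      exact le_antisymm (by linarith) (he k hk)
    obtain ⟨n, g, hg⟩ := abs_form_le.{u, v} hf k
    have h1 := hg e he
    rw [Finset.sum_eq_zero fun i _ => hzero _ fun x => hf ((g i)⁻¹ * x)] at h1
    simpa using h1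

/-- Since every coordinate of the product is some `eval k`, the image of the cone is cut out by
additivity, homogeneity and positivity, all closed conditions. -/
theorem isWeaklyComplete_cone : IsWeaklyComplete (cone.{u, v} f) := by
  rw [isWeaklyComplete_iff]
  have himage : evalDual (WeakStarDual.{u, v} f) '' (cone f : Set (WeakStarDual.{u, v} f))
      = {F | (∀ k l, F (eval (k + l)) = F (eval k) + F (eval l)) ∧
          (∀ (c : ℝ) k, F (eval (c • k)) = c * F (eval k)) ∧
          ∀ k : ellInf f, 0 ≤ (k : G → ℝ) → 0 ≤ F (eval k)} := by
    ext F
    constructor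
    · rintro ⟨e, he, rfl⟩
      exact ⟨fun k l => map_add (form e) k l, fun c k => map_smul (form e) c k, he⟩
    · rintro ⟨hadd, hsmul, hpos⟩
      refine ⟨ofForm { toFun := fun k => F (eval k), map_add' := hadd, map_smul' := hsmul }, hpos,
        funext fun l => ?_⟩
      obtain ⟨k, rfl⟩ := exists_eval_eq l
      rfl
  rw [himage]
  simp only [Set.ofPred_and, Set.ofPred_forall]
  refine (isClosed_iInter fun k => isClosed_iInter fun l => ?_).inter
    ((isClosed_iInter fun c => isClosed_iInter fun k => ?_).inter
      (isClosed_iInter fun k => isClosed_iInter fun _ => ?_))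
  · exact isClosed_eq (continuous_apply _)
      (Continuous.fun_add (continuous_apply (eval k)) (continuous_apply (eval l)))
  · exact isClosed_eq (continuous_apply _) (continuous_const.mul (continuous_apply _))
  · exact isClosed_le continuous_const (continuous_apply _)

/-- The witness is evaluation at a point where `f` is non-zero. Its orbit consists of point
evaluations, and elements of `ℓ^∞(G; f)` are bounded because `f` is. -/
theorem isLocallyBoundedType (hf : 0 ≤ f) (hf0 : f ≠ 0) (hb : IsBoundedFun f) :
    IsLocallyBoundedType (action.{u, v} f) (cone f) := by
  obtain ⟨x, hx⟩ := Function.ne_iff.1 hf0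
  obtain ⟨M, hM⟩ := hb
  refine ⟨ofForm ((LinearMap.proj x).comp (ellInf f).subtype), fun k hk => hk x,
    fun h0 => hx ?_, ?_⟩
  · have h1 := congrArg (fun e => form e ⟨f, self_mem_ellInf hf⟩) h0
    simpa using h1
  · rw [(withSeminorms f).isVonNBounded_iff_seminorm_bounded]
    rintro ⟨k, _⟩
    obtain ⟨n, a, ha⟩ := (gDominates_iff _ _).1 k.2
    refine ⟨n * M + 1, ?_, ?_⟩
    · have := (abs_nonneg _).trans (hM 1)
      positivity
    · rintro _ ⟨g, rfl⟩
      change |(k : G → ℝ) (g⁻¹⁻¹ * x)| < _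
      refine lt_of_le_of_lt ((ha _).trans (Finset.sum_le_sum fun i _ =>
        (le_abs_self _).trans (hM _))) ?_
      simp

theorem isCoboundedType (hf : 0 ≤ f) : IsCoboundedType (action.{u, v} f) (cone f) := by
  refine ⟨eval ⟨f, self_mem_ellInf hf⟩, fun l => ?_⟩
  obtain ⟨k, rfl⟩ := exists_eval_eq l
  obtain ⟨n, g, hg⟩ := abs_form_le.{u, v} hf k
  have hsum (e : WeakStarDual.{u, v} f) : (∑ i, dualRep (action f) (g i)
      (eval ⟨f, self_mem_ellInf hf⟩)) e
      = ∑ i, form e (ellInfTranslate f (g i) ⟨f, self_mem_ellInf hf⟩) := by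
    rw [sum_apply]
    refine Finset.sum_congr rfl fun i _ => ?_
    change form e (ellInfTranslate f (g i)⁻¹⁻¹ _) = _
    rw [inv_inv]
  refine ⟨n, g, fun e he => ?_, fun e he => ?_⟩
  · rw [hsum]
    exact (le_abs_self _).trans (hg e he)
  · rw [hsum]
    exact (neg_le_abs _).trans (hg e he)

end WeakStarDual

-- A non-zero fixed positive form is an integral after rescaling: it is non-zero at `f`, since
-- domination gives `|e k| ≤ n · e f`.
open WeakStarDual in
theorem FixedPointPropertyForCones.exists_isIntegral
    (h : FixedPointPropertyForCones.{u, max u v} G) {f : G → ℝ} (hf : 0 ≤ f) (hf0 : f ≠ 0)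
    (hb : IsBoundedFun f) : ∃ μ : ellInf f →ₗ[ℝ] ℝ, IsIntegral f hf μ := by
  obtain ⟨e, heC, he0, hfix⟩ := h (WeakStarDual.{u, v} f) (cone f) (action f)
    (isProperCone_cone hf) isWeaklyComplete_cone
    (fun g e he k hk => he _ fun x => hk (g⁻¹⁻¹ * x))
    (isLocallyBoundedType hf hf0 hb) (isCoboundedType hf)
  have hinv (g : G) (k : ellInf f) : form e (ellInfTranslate f g k) = form e k := by
    have := form_action g⁻¹ e k
    rw [hfix, inv_inv] at this
    exact this.symm
  have hne : form e ⟨f, self_mem_ellInf hf⟩ ≠ 0 := fun hz => he0 <| ext_form fun k => by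
    obtain ⟨n, g, hg⟩ := abs_form_le.{u, v} hf k
    have := hg e heC
    simpa [hinv, hz] using this
  have hpos := (heC ⟨f, self_mem_ellInf hf⟩ hf).lt_of_ne' hne
  refine ⟨(form e ⟨f, self_mem_ellInf hf⟩)⁻¹ • form e, fun k hk => ?_, fun g k => ?_, ?_⟩
  · exact mul_nonneg (inv_nonneg.2 hpos.le) (heC k hk)
  · exact congrArg (fun r => (form e ⟨f, self_mem_ellInf hf⟩)⁻¹ * r) (hinv g k)
  · exact inv_mul_cancel₀ hne

end FixedPoint
end ConicalFixedPoint

theorem mainTheorem1 (G : Type u) [Group G] :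
    List.TFAE [
      ConicalFixedPoint.FixedPointPropertyForCones.{u, max u v} G,
      ConicalFixedPoint.TranslateProperty G,
      ConicalFixedPoint.AbstractTranslateProperty.{u, max u w} G,
      ∀ (f : G → ℝ) (hf : 0 ≤ f), f ≠ 0 → ConicalFixedPoint.IsBoundedFun f →
        ∃ μ : ConicalFixedPoint.ellInf f →ₗ[ℝ] ℝ, ConicalFixedPoint.IsIntegral f hf μ,
      ∀ f : G → ℝ, f ≠ 0 → ConicalFixedPoint.IsBoundedFun f →
        ConicalFixedPoint.ReiterProperty f] := by
  tfae_have 2 → 4 := fun h f hf hf0 hb => h.exists_isIntegral hf hf0 hb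
  tfae_have 4 → 5 := fun h f hf0 hb => by
    obtain ⟨M, hM⟩ := hb
    obtain ⟨μ, hμ⟩ := h (fun x => |f x|) (fun x => abs_nonneg _)
      (fun hz => hf0 (funext fun x => abs_eq_zero.1 (congrFun hz x)))
      ⟨M, fun x => (abs_abs _).trans_le (hM x)⟩
    exact hμ.reiterProperty
  tfae_have 5 → 2 := fun h f hf hf0 hb n t g hs => (h f hf0 hb).sum_nonneg hf t g hs
  tfae_have 4 → 1 := fun h => ConicalFixedPoint.fixedPointPropertyForCones_of_isIntegral h
  tfae_have 1 → 4 := fun h f hf hf0 hb =>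
    ConicalFixedPoint.FixedPointPropertyForCones.exists_isIntegral.{u, v} h hf hf0 hb
  tfae_have 2 → 3 := fun h => h.abstractTranslateProperty
  tfae_have 3 → 2 := fun h =>
    ConicalFixedPoint.AbstractTranslateProperty.translateProperty.{u, w} G h
  tfae_finish
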